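/- **Setting.** A *problem setting* with $K$ benchmarks consists of a measurable space $\mathcal X$, a label set $\mathcal Y\subseteq[0,1]$, a loss $\ell(f,(x,y))=\ell(f(x),y)$, a class $\mathcal F$ of measurable functions $\mathcal X\to\mathbb R$ with $\ell(f(x),y)\in[0,1]$ for all $f\in\mathcal F$, $x\in\mathcal X$, $y\in\mathcal Y$, benchmark risks $\mathbf R=(\mathcal R_1,\dots,\mathcal R_K):\mathcal F\to[0,1]^K$, where $\mathcal R_k$ is minimized over $\mathcal F$ by $f_k$ and $\operatorname{conv}(f_1,\dots,f_K)\subseteq\mathcal F$, and a nonempty family $\mathcal Q$ of probability distributions on $\mathcal X\times\mathcal Y$. For $Q\in\mathcal Q$ let $\mathcal R_Q(f)=\mathbb E_{(X,Y)\sim Q}\,\ell(f(X),Y)$ and let $\mathcal E_Q(f)=\mathcal R_Q(f)-\min_{k}\mathcal R_Q(f_k)$ be the excess risk. Let $\triangle$ be the probability simplex in $\mathbb R^K$, with vertices $\delta_1,\dots,\delta_K$, and for $\rho\in\triangle$ put $f_\rho=\sum_k\rho_kf_k$. Let $d(f,f')=\max_k\{\mathcal R_k(f)-\mathcal R_k(f')\}$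 and define, for $t\in[0,1]$, $$\overline\omega_Q(t)=\sup\{\mathcal R_Q(f)-\mathcal R_Q(f'):f,f'\in\mathcal F,\ d(f,f')\le t\},\qquad \underline\omega_Q(t)=\inf\{\mathcal R_Q(f')-\mathcal R_Q(f):f,f'\in\mathcal F,\ d(f,f')\le -t\},$$ with $\underline\omega_Q(t)=1$ if the latter set is empty. Finally, let $$\psi_\rho\in\operatorname*{argmin}_{f\in\mathcal F}\max_k\{\mathcal R_k(f)-\mathcal R_k(f_\rho)\},\qquad \Psi(\rho)=\min_k\{\mathcal R_k(f_\rho)-\mathcal R_k(\psi_\rho)\}.$$ **Theorem.** Let $K\ge4$ and $n\ge1$ be integers with $\log(K)/n\le1$. There exists a problem setting with $K$ benchmarks such that the following holds. (i) For every estimator $f_{\hat\rho}$ with values in the convex hull of the dictionary, that is, every map $\hat\rho$ from samples in $(\mathcal X\times\mathcal Y)^n$ to $\triangle$, the excess risk has an expectation under $Q^{\otimes n}$ for every $Q\in\mathcal Q$, and $$\sup_{Q\in\mathcal Q}\mathbb E_{Q^{\otimes n}}\big[\mathcal E_Q(f_{\hat\rho})\big]\ \ge\ \frac1{38}\sqrt{\frac{\log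 K}{n}} .$$ (ii) There is a choice of minimizers $\psi_\rho\in\mathcal F$ ($\rho\in\triangle$) such that, with $(\phi,\Phi)=(\psi,\Psi)$ and the constants $L_\ell=1$, $L_\phi=2$, $\eta=2$, $\kappa=0$, the following assumptions hold for every $Q\in\mathcal Q$: - $\Phi\ge0$ and $\Phi(\delta_k)=0$ for all $k$; - $\Phi(\alpha\rho+(1-\alpha)\gamma)\ge\alpha\Phi(\rho)+(1-\alpha)\Phi(\gamma)+\frac\eta2\alpha(1-\alpha)\|f_\rho-f_\gamma\|_{L^2(Q_X)}^2$ for all $\alpha\in[0,1]$ and $\rho,\gamma\in\triangle$, where $Q_X$ is the marginal of $Q$ on $\mathcal X$; - $\phi_\rho\in\mathcal F$ and $\mathcal R_k(\phi_\rho)=\mathcal R_k(f_\rho)-\Phi(\rho)$ for all $k$ and $\rho$; - $\underline\omega_Q(t)\ge t$ and $\overline\omega_Q(t)\le t$ for all $t\in[0,1]$; - all functions $f_\rho,\phi_\rho$ take values in $[0,1]$; - for every $y\in\mathcal Y$ the map $\ell(\cdot,y)$ is $\kappa$-strongly convex (convex if $\kappa=0$) and $L_\ell$-Lipschitz on $[0,1]$;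 - $|\phi_\rho(x)-\phi_\gamma(x)|\le L_\phi|f_\rho(x)-f_\gamma(x)|$ for all $x\in\mathcal X$ and $\rho,\gamma\in\triangle$. Moreover $\lambda:=\frac1{11L_\ell}\min\big\{\frac1{L_\phi},\frac{\eta+\kappa}{L_\ell+\eta+\kappa}\big\}=\frac1{22}$. With $\hat{\mathcal R}(f)=\frac1n\sum_{i=1}^n\ell(f(x_i),y_i)$, a minimizer $$\hat\rho\in\operatorname*{argmin}_{\rho\in\triangle}\Big\{\tfrac12\hat{\mathcal R}(\phi_\rho)+\tfrac12\sum_k\rho_k\hat{\mathcal R}(f_k)\Big\}$$ exists for every sample, and for every choice of such minimizers the excess risk of $\phi_{\hat\rho}=\psi_{\hat\rho}$ has an expectation under $Q^{\otimes n}$ for every $Q\in\mathcal Q$, and $$\sup_{Q\in\mathcal Q}\mathbb E_{Q^{\otimes n}}\big[\mathcal E_Q(\phi_{\hat\rho})\big]\ \le\ 22\,\frac{\log K}{n}.$$ -/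

import Mathlib

open MeasureTheory Set

noncomputable section

/-- A model selection aggregation problem with `K` benchmarks: a model class `F` of functions on
`X`, a loss `ℓ(f, (x, y)) = loss (f x) y` with labels `y` in a set `Y ⊆ [0,1]`, benchmark risks
`R 1, …, R K : F → [0,1]`, where `R k` is minimized over `F` by the dictionary element `f k`,
and a family `Qs` of candidate target distributions on `X × Y`. The values of `R k` outside `F`
play no role. -/
structure ProblemSetting (K : ℕ) where
  X : Type
  measX : MeasurableSpace X
  Y : Set ℝ
  loss : ℝ → ℝ → ℝ
  F : Set (X → ℝ)
  R : Fin K → (X → ℝ) → ℝ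
  f : Fin K → X → ℝ
  Qs : Set (Measure (X × Y))
  Y_subset : Y ⊆ Icc 0 1
  measurable_loss : Measurable fun p : ℝ × ℝ => loss p.1 p.2
  measurable_of_mem : ∀ g ∈ F, Measurable g
  loss_mem : ∀ g ∈ F, ∀ x, ∀ y ∈ Y, loss (g x) y ∈ Icc (0 : ℝ) 1
  R_mem : ∀ k, ∀ g ∈ F, R k g ∈ Icc (0 : ℝ) 1
  f_isMinOn : ∀ k, IsMinOn (R k) F (f k)
  convexHull_subset : convexHull ℝ (range f) ⊆ F
  Qs_nonempty : Qs.Nonempty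
  isProbabilityMeasure : ∀ Q ∈ Qs, IsProbabilityMeasure Q

attribute [instance] ProblemSetting.measX

namespace ProblemSetting

variable {K : ℕ} (S : ProblemSetting K)

/-- The observation space. -/
abbrev Z : Type := S.X × S.Y

/-- The target risk `R_Q(g) = E_{(x,y) ∼ Q} ℓ(g(x), y)`. -/
def risk (Q : Measure S.Z) (g : S.X → ℝ) : ℝ := ∫ z, S.loss (g z.1) z.2 ∂Q

/-- The empirical risk of `g` on the sample `z`. -/
def empRisk {n : ℕ} (z : Fin n → S.Z) (g : S.X → ℝ) : ℝ :=
  (1 / n : ℝ) * ∑ i, S.loss (g (z i).1) (z i).2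

/-- The convex combination `f_ρ = ∑ k, ρ k • f k` of the dictionary. -/
def mix (ρ : Fin K → ℝ) : S.X → ℝ := fun x => ∑ k, ρ k * S.f k x

/-- The excess risk of `g` relative to the dictionary. -/
def excessRisk (Q : Measure S.Z) (g : S.X → ℝ) : ℝ := S.risk Q g - ⨅ k, S.risk Q (S.f k)

/-- The expected excess risk of the estimator `est` on `n` i.i.d. observations from `Q`. -/
def expectedExcessRisk {n : ℕ} (est : (Fin n → S.Z) → S.X → ℝ) (Q : Measure S.Z) : ℝ :=
  ∫ z, S.excessRisk Q (est z) ∂(Measure.pi fun _ : Fin n => Q)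

/-- The expected excess risk in the worst case over the family of targets. (The family is
nonempty, and the expected excess risks of estimators with values in `F` lie in `[-1,1]`.) -/
def worstCaseExcessRisk {n : ℕ} (est : (Fin n → S.Z) → S.X → ℝ) : ℝ :=
  ⨆ Q : S.Qs, S.expectedExcessRisk est Q

/-- The excess risk of `est` is an integrable random variable under every target. -/
def HasExpectedExcessRisk {n : ℕ} (est : (Fin n → S.Z) → S.X → ℝ) : Prop :=
  ∀ Q ∈ S.Qs, Integrable (fun z => S.excessRisk Q (est z)) (Measure.pi fun _ : Fin n => Q)

/-- The Pareto distance `d(g, g') = max_k (R_k(g) - R_k(g'))`. -/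
def paretoDist (g g' : S.X → ℝ) : ℝ := ⨆ k, (S.R k g - S.R k g')

/-- The upper modulus of monotonicity. -/
def upperModulus (Q : Measure S.Z) (t : ℝ) : ℝ :=
  sSup {r | ∃ g ∈ S.F, ∃ g' ∈ S.F, S.paretoDist g g' ≤ t ∧ r = S.risk Q g - S.risk Q g'}

open Classical in
/-- The lower modulus of monotonicity, equal to `1` if no pair of models qualifies. -/
def lowerModulus (Q : Measure S.Z) (t : ℝ) : ℝ :=
  if ∃ g ∈ S.F, ∃ g' ∈ S.F, S.paretoDist g g' ≤ -t then
    sInf {r | ∃ g ∈ S.F, ∃ g' ∈ S.F, S.paretoDist g g' ≤ -t ∧ r = S.risk Q g' - S.risk Q g}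
  else 1

/-- `ψ_ρ ∈ argmin_{g ∈ F} max_k (R_k(g) - R_k(f_ρ))` for every `ρ` in the simplex. -/
def IsParetoMap (ψ : (Fin K → ℝ) → S.X → ℝ) : Prop :=
  ∀ ρ ∈ stdSimplex ℝ (Fin K),
    ψ ρ ∈ S.F ∧ IsMinOn (fun g => S.paretoDist g (S.mix ρ)) S.F (ψ ρ)

/-- `Ψ(ρ) = min_k (R_k(f_ρ) - R_k(ψ_ρ))`. -/
def paretoGap (ψ : (Fin K → ℝ) → S.X → ℝ) (ρ : Fin K → ℝ) : ℝ :=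
  ⨅ k, (S.R k (S.mix ρ) - S.R k (ψ ρ))

/-- The squared distance `‖g - g'‖²` in `L²(Q_X)`, with `Q_X` the marginal of `Q` on `X`. -/
def sqDist (Q : Measure S.Z) (g g' : S.X → ℝ) : ℝ :=
  ∫ x, (g x - g' x) ^ 2 ∂(Q.map Prod.fst)

/-- `Φ` is a Pareto gap that is `η`-strongly concave in `L²(Q_X)`, and it is realized
by the models `φ_ρ ∈ F`. -/
structure StronglyConcaveParetoGap (Q : Measure S.Z) (φ : (Fin K → ℝ) → S.X → ℝ)
    (Φ : (Fin K → ℝ) → ℝ) (η : ℝ) : Prop where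
  nonneg : ∀ ρ ∈ stdSimplex ℝ (Fin K), 0 ≤ Φ ρ
  dirac : ∀ k, Φ (Pi.single k 1) = 0
  concave : ∀ α ∈ Icc (0 : ℝ) 1, ∀ ρ ∈ stdSimplex ℝ (Fin K), ∀ γ ∈ stdSimplex ℝ (Fin K),
    α * Φ ρ + (1 - α) * Φ γ + η / 2 * α * (1 - α) * S.sqDist Q (S.mix ρ) (S.mix γ)
      ≤ Φ (α • ρ + (1 - α) • γ)
  mem : ∀ ρ ∈ stdSimplex ℝ (Fin K), φ ρ ∈ S.F
  realized : ∀ ρ ∈ stdSimplex ℝ (Fin K), ∀ k, S.R k (φ ρ) = S.R k (S.mix ρ) - Φ ρ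

/-- The assumptions under which the fast-rate aggregator is studied, for the target `Q`.
(Labels are in `[0,1]` in every `ProblemSetting`.) -/
structure FastRateAssumptions (Q : Measure S.Z) (φ : (Fin K → ℝ) → S.X → ℝ)
    (Φ : (Fin K → ℝ) → ℝ) (Ll Lφ η κ : ℝ) : Prop where
  gap : S.StronglyConcaveParetoGap Q φ Φ η
  lower : ∀ t ∈ Icc (0 : ℝ) 1, t ≤ S.lowerModulus Q t
  upper : ∀ t ∈ Icc (0 : ℝ) 1, S.upperModulus Q t ≤ t
  mix_mem : ∀ ρ ∈ stdSimplex ℝ (Fin K), ∀ x, S.mix ρ x ∈ Icc (0 : ℝ) 1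
  map_mem : ∀ ρ ∈ stdSimplex ℝ (Fin K), ∀ x, φ ρ x ∈ Icc (0 : ℝ) 1
  strongConvex : ∀ y ∈ S.Y, StrongConvexOn (Icc (0 : ℝ) 1) κ fun v => S.loss v y
  lipschitz_loss : ∀ y ∈ S.Y, ∀ v ∈ Icc (0 : ℝ) 1, ∀ v' ∈ Icc (0 : ℝ) 1,
    |S.loss v y - S.loss v' y| ≤ Ll * |v - v'|
  lipschitz_map : ∀ ρ ∈ stdSimplex ℝ (Fin K), ∀ γ ∈ stdSimplex ℝ (Fin K), ∀ x,
    |φ ρ x - φ γ x| ≤ Lφ * |S.mix ρ x - S.mix γ x|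

/-- The objective `½ R̂(φ_ρ) + ½ E_{k ∼ ρ} R̂(f_k)` of the fast-rate aggregator. -/
def aggObjective {n : ℕ} (φ : (Fin K → ℝ) → S.X → ℝ) (z : Fin n → S.Z) (ρ : Fin K → ℝ) : ℝ :=
  1 / 2 * S.empRisk z (φ ρ) + 1 / 2 * ∑ k, ρ k * S.empRisk z (S.f k)

/-- `ρhat` is a fast-rate aggregator: on every sample it minimizes the objective over
the simplex. -/
def IsFastRateAggregator {n : ℕ} (φ : (Fin K → ℝ) → S.X → ℝ)
    (ρhat : (Fin n → S.Z) → Fin K → ℝ) : Prop :=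
  ∀ z, ρhat z ∈ stdSimplex ℝ (Fin K) ∧
    IsMinOn (S.aggObjective φ z) (stdSimplex ℝ (Fin K)) (ρhat z)

end ProblemSetting

/-- The constant `λ` of the fast rate `log(K) / (λ n)`. -/
def fastRateLambda (Ll Lφ η κ : ℝ) : ℝ :=
  1 / (11 * Ll) * min (1 / Lφ) ((η + κ) / (Ll + η + κ))

end

noncomputable section

namespace HypercubeAggregation

open scoped BigOperators

variable {K : ℕ}

/-! The sample space is the cube, the dictionary consists of its coordinates, and every target
produces only the label `0`, so the absolute loss of a `[0,1]`-valued model is its value. The target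
`target ε j` tilts the `j`-th coordinate by `ε`; benchmark `k` is the extreme tilt `1/2` of
coordinate `k`. The models are the mixtures `bitMix ρ` and their squares. With `S = ∑ ρ_k spin_k`,
they equal `(1 - S)/2` and `(1 - 2S + S²)/4`. Both have `S`-coefficient `-1/2`, and odd moments
vanish, so the `j`-tilted means are `1/2 - ε ρ_j` and `(1 + |ρ|²)/4 - ε ρ_j`. Squaring therefore
gains exactly `(1 - |ρ|²)/4` under every tilt; this is the strongly concave Pareto gap.

Lower bound: a mixture has excess risk `ε (1 - ρ_j)`. For `ε = √(log K / n) / 8` a second moment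
bound on the likelihood ratios shows that the tilted coordinate cannot be identified
(`exists_sum_prod_tiltDensity_mul_le`), which costs `ε / 4`.

Upper bound: a square has excess risk `ε (1 - ρ_j) - (1 - |ρ|²)/4`, which never exceeds `ε`. This
suffices unless `ε` is small. For small `ε`, positive excess forces `ρ` to concentrate on a wrong
coordinate `k ≠ j`. The objective at the midpoint of `k` and `j` is then smaller by a constant on
average, so a Chernoff bound (`tiltMean_exp_midpointLoss_le`) and a union bound over `k` make this
exponentially unlikely. -/

/-- The `k`-th coordinate of a vertex of the cube, as a sign: `1` for `false`, `-1` for `true`. -/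
def spin (k : Fin K) (x : Fin K → Bool) : ℝ := if x k then -1 else 1

/-- The `k`-th coordinate of a vertex of the cube, as a number in `{0, 1}`. -/
def bit (k : Fin K) (x : Fin K → Bool) : ℝ := if x k then 1 else 0

lemma bit_eq (k : Fin K) (x : Fin K → Bool) : bit k x = (1 - spin k x) / 2 := by
  unfold bit spin; split_ifs <;> norm_num

lemma bit_mem (k : Fin K) (x : Fin K → Bool) : bit k x ∈ Icc (0 : ℝ) 1 := by
  unfold bit; split_ifs <;> simp

lemma spin_mem (k : Fin K) (x : Fin K → Bool) : spin k x ∈ Icc (-1 : ℝ) 1 := by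
  unfold spin; split_ifs <;> simp

lemma spin_mul_self (k : Fin K) (x : Fin K → Bool) : spin k x * spin k x = 1 := by
  unfold spin; split_ifs <;> norm_num

/-- A linear combination of the signs. -/
def spinSum (c : Fin K → ℝ) (x : Fin K → Bool) : ℝ := ∑ k, c k * spin k x

/-- The convex combination of the coordinates. -/
def bitMix (ρ : Fin K → ℝ) (x : Fin K → Bool) : ℝ := ∑ k, ρ k * bit k x

lemma bitMix_sub (ρ γ : Fin K → ℝ) (h : ∑ k, ρ k = ∑ k, γ k) (x : Fin K → Bool) :
    bitMix ρ x - bitMix γ x = -spinSum (ρ - γ) x / 2 := by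
  have e : ∀ c : Fin K → ℝ, bitMix c x = ((∑ k, c k) - spinSum c x) / 2 := fun c => by
    simp only [bitMix, spinSum, bit_eq, ← Finset.sum_sub_distrib, Finset.sum_div]
    exact Finset.sum_congr rfl fun k _ => by ring
  have e' : spinSum (ρ - γ) x = spinSum ρ x - spinSum γ x := by
    simp only [spinSum, ← Finset.sum_sub_distrib, Pi.sub_apply, sub_mul]
  rw [e, e, e', h]; ring

lemma bitMix_eq {ρ : Fin K → ℝ} (h : ∑ k, ρ k = 1) (x : Fin K → Bool) :
    bitMix ρ x = (1 - spinSum ρ x) / 2 := by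
  rw [← h]
  simp only [bitMix, spinSum, bit_eq, ← Finset.sum_sub_distrib, Finset.sum_div]
  exact Finset.sum_congr rfl fun k _ => by ring

lemma bitMix_mem {ρ : Fin K → ℝ} (h : ρ ∈ stdSimplex ℝ (Fin K)) (x : Fin K → Bool) :
    bitMix ρ x ∈ Icc (0 : ℝ) 1 := by
  refine ⟨Finset.sum_nonneg fun k _ => mul_nonneg (h.1 k) (bit_mem k x).1, ?_⟩
  rw [← h.2]
  exact Finset.sum_le_sum fun k _ => mul_le_of_le_one_right (h.1 k) (bit_mem k x).2

lemma bitMix_single (k : Fin K) : bitMix (Pi.single k 1) = bit k := by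
  ext x
  simp [bitMix, Pi.single_apply]

/-! ### Means over the cube -/

/-- Flipping all coordinates preserves the uniform distribution. -/
lemma expect_eq_zero_of_odd {g : (Fin K → Bool) → ℝ} (h : ∀ x, g (fun k => !x k) = -g x) :
    𝔼 x, g x = 0 := by
  have hinv : Function.Involutive fun (x : Fin K → Bool) k => !x k := fun x => by simp
  have := Fintype.expect_equiv hinv.toPerm (fun x => g fun k => !x k) g fun x => rfl
  simp only [h, Finset.expect_neg_distrib] at this
  linarith

lemma spin_not (k : Fin K) (x : Fin K → Bool) : spin k (fun l => !x l) = -spin k x := by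
  unfold spin; cases h : x k <;> simp [h]

lemma spinSum_not (c : Fin K → ℝ) (x : Fin K → Bool) :
    spinSum c (fun l => !x l) = -spinSum c x := by
  simp [spinSum, spin_not]

lemma expect_spin (k : Fin K) : 𝔼 x, spin k x = 0 :=
  expect_eq_zero_of_odd (spin_not k)

lemma expect_spinSum (c : Fin K → ℝ) : 𝔼 x, spinSum c x = 0 :=
  expect_eq_zero_of_odd (spinSum_not c)

lemma expect_spin_mul_spinSum_sq (k : Fin K) (c : Fin K → ℝ) :
    𝔼 x, spin k x * spinSum c x ^ 2 = 0 :=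
  expect_eq_zero_of_odd fun x => by rw [spin_not, spinSum_not]; ring

/-- Flipping only the `k`-th coordinate changes the sign of the product. -/
lemma expect_spin_mul_spin_of_ne {k l : Fin K} (h : k ≠ l) : 𝔼 x, spin k x * spin l x = 0 := by
  have hinv : Function.Involutive fun (x : Fin K → Bool) => Function.update x k (!x k) :=
    fun x => by simp
  have := Fintype.expect_equiv hinv.toPerm (fun x => -(spin k x * spin l x))
    (fun x => spin k x * spin l x) fun x => by
      simp only [spin, Function.Involutive.coe_toPerm, Function.update_self,
        Function.update_of_ne h.symm]
      cases x k <;> simp <;> split_ifs <;> norm_num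
  rw [Finset.expect_neg_distrib] at this
  linarith

lemma expect_spin_mul_spin (k l : Fin K) :
    𝔼 x, spin k x * spin l x = if l = k then 1 else 0 := by
  split_ifs with h
  · subst h
    simp only [spin_mul_self]
    exact Finset.expect_const Finset.univ_nonempty _
  · exact expect_spin_mul_spin_of_ne (Ne.symm h)

lemma expect_spin_mul_spinSum (k : Fin K) (c : Fin K → ℝ) :
    𝔼 x, spin k x * spinSum c x = c k := by
  simp only [spinSum, Finset.mul_sum, mul_left_comm (spin k _)]
  rw [Finset.expect_sum_comm]
  simp only [← Finset.mul_expect, expect_spin_mul_spin]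
  simp

lemma expect_spinSum_sq (c : Fin K → ℝ) : 𝔼 x, spinSum c x ^ 2 = ∑ k, c k ^ 2 := by
  have : ∀ x : Fin K → Bool, spinSum c x ^ 2 = ∑ k, c k * (spin k x * spinSum c x) := fun x => by
    simp only [← mul_assoc, ← Finset.sum_mul]
    rw [sq]; rfl
  simp only [this]
  rw [Finset.expect_sum_comm]
  simp only [← Finset.mul_expect, expect_spin_mul_spinSum, sq]

/-- The mean of `g` over the cube with `k`-th coordinate tilted towards `false`. -/
def tiltMean (ε : ℝ) (k : Fin K) (g : (Fin K → Bool) → ℝ) : ℝ :=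
  𝔼 x, (1 + 2 * ε * spin k x) * g x

lemma tiltMean_mono {ε : ℝ} (hε : ε ∈ Icc (0 : ℝ) (1 / 2)) (k : Fin K)
    {g g' : (Fin K → Bool) → ℝ} (h : ∀ x, g x ≤ g' x) : tiltMean ε k g ≤ tiltMean ε k g' := by
  refine Finset.expect_le_expect fun x _ => mul_le_mul_of_nonneg_left (h x) ?_
  nlinarith [(spin_mem k x).1, hε.1, hε.2]

/-- The tilted mean of a quadratic polynomial in a linear combination of the signs. -/
lemma tiltMean_quadratic (ε : ℝ) (k : Fin K) (c : Fin K → ℝ) (a b d : ℝ) :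
    tiltMean ε k (fun x => a + b * spinSum c x + d * spinSum c x ^ 2) =
      a + 2 * ε * b * c k + d * ∑ l, c l ^ 2 := by
  have e : ∀ x : Fin K → Bool,
      (1 + 2 * ε * spin k x) * (a + b * spinSum c x + d * spinSum c x ^ 2) =
      a + (b * spinSum c x + (d * spinSum c x ^ 2 + (2 * ε * a * spin k x +
        (2 * ε * b * (spin k x * spinSum c x) + 2 * ε * d * (spin k x * spinSum c x ^ 2))))) :=
    fun x => by ring
  simp only [tiltMean, e, Finset.expect_add_distrib, ← Finset.mul_expect, expect_spin,
    expect_spinSum, expect_spinSum_sq, expect_spin_mul_spinSum, expect_spin_mul_spinSum_sq]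
  rw [Finset.expect_const Finset.univ_nonempty]; ring

lemma tiltMean_one (ε : ℝ) (k : Fin K) : tiltMean ε k (fun _ => 1) = 1 := by
  simpa using tiltMean_quadratic ε k 0 1 0 0

lemma tiltMean_bitMix (ε : ℝ) (k : Fin K) {ρ : Fin K → ℝ} (h : ∑ k, ρ k = 1) :
    tiltMean ε k (bitMix ρ) = 1 / 2 - ε * ρ k := by
  have e : bitMix ρ = fun x => 1 / 2 + (-1 / 2) * spinSum ρ x + 0 * spinSum ρ x ^ 2 := by
    ext x; rw [bitMix_eq h]; ring
  rw [e, tiltMean_quadratic]; ring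

/-- The tilt enters as in `tiltMean_bitMix`, because squaring leaves the linear coefficient in the
signs at `-1/2`. -/
lemma tiltMean_bitMix_sq (ε : ℝ) (k : Fin K) {ρ : Fin K → ℝ} (h : ∑ k, ρ k = 1) :
    tiltMean ε k (fun x => bitMix ρ x ^ 2) = (1 + ∑ l, ρ l ^ 2) / 4 - ε * ρ k := by
  have e : (fun x => bitMix ρ x ^ 2) =
      fun x => 1 / 4 + (-1 / 2) * spinSum ρ x + 1 / 4 * spinSum ρ x ^ 2 := by
    ext x; rw [bitMix_eq h]; ring
  rw [e, tiltMean_quadratic]; ring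

lemma tiltMean_bitMix_sub_sq (ε : ℝ) (k : Fin K) {ρ γ : Fin K → ℝ} (h : ∑ k, ρ k = ∑ k, γ k) :
    tiltMean ε k (fun x => (bitMix ρ x - bitMix γ x) ^ 2) = (∑ l, (ρ l - γ l) ^ 2) / 4 := by
  have e : (fun x => (bitMix ρ x - bitMix γ x) ^ 2) =
      fun x => 0 + 0 * spinSum (ρ - γ) x + 1 / 4 * spinSum (ρ - γ) x ^ 2 := by
    ext x; rw [bitMix_sub ρ γ h]; ring
  rw [e, tiltMean_quadratic]; simp only [Pi.sub_apply]; ring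

/-- The tilted mean of a function of two coordinates. -/
lemma tiltMean_pair (ε : ℝ) {j k : Fin K} (h : k ≠ j) (a b c d : ℝ) :
    tiltMean ε j (fun x => a + b * spin k x + c * spin j x + d * (spin k x * spin j x)) =
      a + 2 * ε * c := by
  have e : ∀ x : Fin K → Bool, (1 + 2 * ε * spin j x) *
      (a + b * spin k x + c * spin j x + d * (spin k x * spin j x)) =
      (a + 2 * ε * c) + ((b + 2 * ε * d) * spin k x + ((c + 2 * ε * a) * spin j x +
        (d + 2 * ε * b) * (spin k x * spin j x))) :=
    fun x => by linear_combination (2 * ε * c + 2 * ε * d * spin k x) * spin_mul_self j x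
  simp only [tiltMean, e, Finset.expect_add_distrib, ← Finset.mul_expect, expect_spin,
    expect_spin_mul_spin_of_ne h, Finset.expect_const Finset.univ_nonempty]
  ring

/-! ### Tilted measures, targets and integrals over samples -/

/-- The density of the tilted distribution on the cube with respect to the counting measure. -/
def tiltDensity (ε : ℝ) (k : Fin K) (x : Fin K → Bool) : ℝ := (1 + 2 * ε * spin k x) / 2 ^ K

/-- The distribution on the cube with independent coordinates, of which the `k`-th is `true`
with probability `1 / 2 - ε` and the others are uniform. -/
def tiltMeasure (ε : ℝ) (k : Fin K) : Measure (Fin K → Bool) :=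
  Measure.count.withDensity fun x => ENNReal.ofReal (tiltDensity ε k x)

lemma tiltDensity_nonneg {ε : ℝ} (hε : ε ∈ Icc (0 : ℝ) (1 / 2)) (k : Fin K) (x : Fin K → Bool) :
    0 ≤ tiltDensity ε k x := by
  refine div_nonneg ?_ (by positivity)
  nlinarith [(spin_mem k x).1, hε.1, hε.2]

lemma sum_tiltDensity_mul (ε : ℝ) (k : Fin K) (g : (Fin K → Bool) → ℝ) :
    ∑ x, tiltDensity ε k x * g x = tiltMean ε k g := by
  rw [tiltMean, Fintype.expect_eq_sum_div_card, Finset.sum_div]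
  refine Finset.sum_congr rfl fun x _ => ?_
  simp only [tiltDensity, Fintype.card_pi, Fintype.card_bool, Finset.prod_const, Finset.card_univ,
    Fintype.card_fin, Nat.cast_pow, Nat.cast_ofNat]
  ring

lemma tiltMeasure_singleton (ε : ℝ) (k : Fin K) (x : Fin K → Bool) :
    tiltMeasure ε k {x} = ENNReal.ofReal (tiltDensity ε k x) := by
  rw [tiltMeasure, withDensity_apply _ (measurableSet_singleton x), Measure.restrict_singleton,
    lintegral_smul_measure, lintegral_dirac, Measure.count_singleton, one_smul]

lemma isProbabilityMeasure_tiltMeasure {ε : ℝ} (hε : ε ∈ Icc (0 : ℝ) (1 / 2)) (k : Fin K) :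
    IsProbabilityMeasure (tiltMeasure ε k) := by
  refine ⟨?_⟩
  have h := sum_tiltDensity_mul ε k fun _ => 1
  simp only [mul_one, tiltMean_one] at h
  rw [← Finset.coe_univ, ← sum_measure_singleton]
  simp only [tiltMeasure_singleton]
  rw [← ENNReal.ofReal_sum_of_nonneg fun x _ => tiltDensity_nonneg hε k x, h, ENNReal.ofReal_one]

lemma integral_tiltMeasure {ε : ℝ} (hε : ε ∈ Icc (0 : ℝ) (1 / 2)) (k : Fin K)
    (g : (Fin K → Bool) → ℝ) : ∫ x, g x ∂(tiltMeasure ε k) = tiltMean ε k g := by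
  have := isProbabilityMeasure_tiltMeasure hε k
  rw [integral_fintype Integrable.of_finite, ← sum_tiltDensity_mul]
  refine Finset.sum_congr rfl fun x _ => ?_
  rw [measureReal_def, tiltMeasure_singleton, ENNReal.toReal_ofReal (tiltDensity_nonneg hε k x),
    smul_eq_mul]

/-- The labels. -/
abbrev Labels : Set ℝ := {0, 1}

/-- Attach the label `0` to a point of the cube. -/
def labelled (x : Fin K → Bool) : (Fin K → Bool) × Labels := (x, ⟨0, Or.inl rfl⟩)

/-- The target distribution: a tilted point of the cube with label `0`. -/
def target (ε : ℝ) (k : Fin K) : Measure ((Fin K → Bool) × Labels) :=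
  (tiltMeasure ε k).map labelled

lemma measurable_labelled : Measurable (labelled (K := K)) := Measurable.of_discrete

lemma isProbabilityMeasure_target {ε : ℝ} (hε : ε ∈ Icc (0 : ℝ) (1 / 2)) (k : Fin K) :
    IsProbabilityMeasure (target ε k) :=
  have := isProbabilityMeasure_tiltMeasure hε k
  Measure.isProbabilityMeasure_map measurable_labelled.aemeasurable

lemma target_map_fst (ε : ℝ) (k : Fin K) : (target ε k).map Prod.fst = tiltMeasure ε k := by
  rw [target, Measure.map_map measurable_fst measurable_labelled]
  exact Measure.map_id

lemma integral_target {ε : ℝ} (hε : ε ∈ Icc (0 : ℝ) (1 / 2)) (k : Fin K)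
    (g : (Fin K → Bool) × Labels → ℝ) :
    ∫ z, g z ∂(target ε k) = tiltMean ε k fun x => g (labelled x) := by
  rw [target, integral_map measurable_labelled.aemeasurable
    Measurable.of_discrete.aestronglyMeasurable, integral_tiltMeasure hε]

lemma integral_pi_target {ε : ℝ} (hε : ε ∈ Icc (0 : ℝ) (1 / 2)) (k : Fin K) {n : ℕ}
    (g : (Fin n → (Fin K → Bool) × Labels) → ℝ) :
    ∫ z, g z ∂(Measure.pi fun _ : Fin n => target ε k) =
      ∑ x : Fin n → Fin K → Bool, (∏ i, tiltDensity ε k (x i)) * g fun i => labelled (x i) := by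
  have := isProbabilityMeasure_tiltMeasure hε k
  have := isProbabilityMeasure_target hε k
  have e : (Measure.pi fun _ : Fin n => target ε k) =
      (Measure.pi fun _ : Fin n => tiltMeasure ε k).map fun x i => labelled (x i) := by
    rw [Measure.pi_map_pi fun _ => measurable_labelled.aemeasurable]; rfl
  rw [e, integral_map Measurable.of_discrete.aemeasurable
    Measurable.of_discrete.aestronglyMeasurable, integral_fintype Integrable.of_finite]
  refine Finset.sum_congr rfl fun x _ => ?_
  rw [measureReal_def, Measure.pi_singleton, ENNReal.toReal_prod, smul_eq_mul]
  simp only [tiltMeasure_singleton, ENNReal.toReal_ofReal (tiltDensity_nonneg hε k _)]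

/-! ### The problem setting -/

lemma sq_sum_le_one {ρ : Fin K → ℝ} (h : ρ ∈ stdSimplex ℝ (Fin K)) : ∑ k, ρ k ^ 2 ≤ 1 := by
  rw [← h.2]
  refine Finset.sum_le_sum fun k _ => ?_
  have : ρ k ≤ 1 := h.2 ▸ Finset.single_le_sum (fun l _ => h.1 l) (Finset.mem_univ k)
  nlinarith [h.1 k]

/-- The squares of the convex combinations of the coordinates. -/
def bitMixSq (ρ : Fin K → ℝ) (x : Fin K → Bool) : ℝ := bitMix ρ x ^ 2

lemma bitMixSq_mem {ρ : Fin K → ℝ} (h : ρ ∈ stdSimplex ℝ (Fin K)) (x : Fin K → Bool) :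
    bitMixSq ρ x ∈ Icc (0 : ℝ) 1 := by
  have := bitMix_mem h x
  exact ⟨sq_nonneg _, pow_le_one₀ this.1 this.2⟩

/-- The model class: the convex combinations of the coordinates and their squares. -/
def models (K : ℕ) : Set ((Fin K → Bool) → ℝ) :=
  {g | ∃ ρ ∈ stdSimplex ℝ (Fin K), g = bitMix ρ ∨ g = bitMixSq ρ}

lemma mem_Icc_of_mem_models {g : (Fin K → Bool) → ℝ} (hg : g ∈ models K) (x : Fin K → Bool) :
    g x ∈ Icc (0 : ℝ) 1 := by
  obtain ⟨ρ, hρ, rfl | rfl⟩ := hg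
  exacts [bitMix_mem hρ x, bitMixSq_mem hρ x]

/-- One pair `(ρ, m)` describes the risks of a model under all benchmarks and all targets at once.
The bound on `m` is an equality for squares, so no model with the same `ρ` does better. -/
lemma exists_tiltMean_eq {g : (Fin K → Bool) → ℝ} (hg : g ∈ models K) :
    ∃ ρ ∈ stdSimplex ℝ (Fin K), ∃ m : ℝ, (1 + ∑ l, ρ l ^ 2) / 4 ≤ m ∧
      ∀ ε k, tiltMean ε k g = m - ε * ρ k := by
  obtain ⟨ρ, hρ, rfl | rfl⟩ := hg
  · exact ⟨ρ, hρ, 1 / 2, by linarith [sq_sum_le_one hρ], fun ε k => tiltMean_bitMix ε k hρ.2⟩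
  · exact ⟨ρ, hρ, _, le_rfl, fun ε k => tiltMean_bitMix_sq ε k hρ.2⟩

lemma tiltMean_bit_self (k : Fin K) : tiltMean (1 / 2) k (bit k) = 0 := by
  rw [← bitMix_single, tiltMean_bitMix _ _ (by simp)]; simp

lemma convexHull_range_bit_subset : convexHull ℝ (range (bit (K := K))) ⊆ models K := by
  have hconv : Convex ℝ (bitMix '' stdSimplex ℝ (Fin K)) := by
    refine (convex_stdSimplex ℝ (Fin K)).is_linear_image ⟨fun a b => ?_, fun a b => ?_⟩
    · ext x; simp [bitMix, add_mul, Finset.sum_add_distrib]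
    · ext x; simp [bitMix, mul_assoc, Finset.mul_sum]
  refine (convexHull_min ?_ hconv).trans ?_
  · rintro _ ⟨k, rfl⟩
    exact ⟨_, single_mem_stdSimplex ℝ k, bitMix_single k⟩
  · rintro _ ⟨ρ, hρ, rfl⟩
    exact ⟨ρ, hρ, Or.inl rfl⟩

lemma bit_mem_models (k : Fin K) : bit k ∈ models K :=
  convexHull_range_bit_subset (subset_convexHull ℝ _ (mem_range_self k))

/-- Absolute loss on the cube with the coordinates as dictionary; the `k`-th benchmark forces the
`k`-th coordinate to `0`, and under the `k`-th target it is slightly biased towards `0`. -/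
def setting (K : ℕ) [NeZero K] (ε : ℝ) (hε : ε ∈ Icc (0 : ℝ) (1 / 2)) : ProblemSetting K where
  X := Fin K → Bool
  measX := inferInstance
  Y := Labels
  loss v y := |v - y|
  F := models K
  R := tiltMean (1 / 2)
  f := bit
  Qs := range (target ε)
  Y_subset := by rintro y (rfl | rfl) <;> simp
  measurable_loss := by fun_prop
  measurable_of_mem _ _ := Measurable.of_discrete
  loss_mem g hg x y hy := by
    have := mem_Icc_of_mem_models hg x
    obtain ⟨h0, h1⟩ := this
    rcases hy with rfl | rfl
    · rw [sub_zero, abs_of_nonneg h0]; exact ⟨h0, h1⟩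
    · rw [abs_of_nonpos (by linarith)]; constructor <;> linarith
  R_mem k g hg := by
    have hh : (1 / 2 : ℝ) ∈ Icc (0 : ℝ) (1 / 2) := by norm_num
    constructor
    · have := tiltMean_mono hh k fun x => (mem_Icc_of_mem_models hg x).1
      simpa [tiltMean] using this
    · exact (tiltMean_mono hh k fun x => (mem_Icc_of_mem_models hg x).2).trans_eq
        (tiltMean_one _ k)
  f_isMinOn k g hg := by
    have hh : (1 / 2 : ℝ) ∈ Icc (0 : ℝ) (1 / 2) := by norm_num
    have := tiltMean_mono hh k fun x => (mem_Icc_of_mem_models hg x).1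
    rw [mem_ofPred_eq, tiltMean_bit_self]
    simpa [tiltMean] using this
  convexHull_subset := convexHull_range_bit_subset
  Qs_nonempty := range_nonempty _
  isProbabilityMeasure := by
    rintro _ ⟨k, rfl⟩
    exact isProbabilityMeasure_target hε k

/-! ### Risks, monotonicity and the Pareto map -/

section Setting

variable [NeZero K] {ε : ℝ} (hε : ε ∈ Icc (0 : ℝ) (1 / 2))

lemma risk_target {g : (Fin K → Bool) → ℝ} (hg : g ∈ models K) (j : Fin K) :
    (setting K ε hε).risk (target ε j) g = tiltMean ε j g := by
  refine (integral_target hε j _).trans (congrArg _ (funext fun x => ?_))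
  change |g x - 0| = g x
  rw [sub_zero, abs_of_nonneg (mem_Icc_of_mem_models hg x).1]

lemma excessRisk_target {g : (Fin K → Bool) → ℝ} (hg : g ∈ models K) (j : Fin K) :
    (setting K ε hε).excessRisk (target ε j) g = tiltMean ε j g - (1 / 2 - ε) := by
  have e : ∀ k, (setting K ε hε).risk (target ε j) ((setting K ε hε).f k) =
      1 / 2 - ε * (Pi.single k 1 : Fin K → ℝ) j := fun k => by
    refine (risk_target hε (bit_mem_models k) j).trans ?_
    rw [← bitMix_single, tiltMean_bitMix _ _ (by simp)]
  have hinf : ⨅ k, (setting K ε hε).risk (target ε j) ((setting K ε hε).f k) = 1 / 2 - ε := by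
    refine le_antisymm ((ciInf_le (finite_range _).bddBelow j).trans ?_) (le_ciInf fun k => ?_)
    · rw [e]; simp
    · rw [e]
      by_cases h : j = k
      · subst h; simp
      · simp [Pi.single_eq_of_ne h, hε.1]
  change (setting K ε hε).risk (target ε j) g - _ = _
  rw [hinf, risk_target hε hg]

lemma paretoDist_le_iff (g g' : (Fin K → Bool) → ℝ) (t : ℝ) :
    (setting K ε hε).paretoDist g g' ≤ t ↔
      ∀ k, tiltMean (1 / 2) k g - tiltMean (1 / 2) k g' ≤ t :=
  ciSup_le_iff (finite_range _).bddAbove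

/-- A target risk is the convex combination, with weights `2ε` and `1 - 2ε`, of the `j`-th benchmark
risk and the untilted mean `m`. Averaging the benchmark inequalities over `k` controls `m - m'`,
since `ρ` and `ρ'` both have total mass `1`. -/
lemma risk_sub_risk_le {g g' : (Fin K → Bool) → ℝ} (hg : g ∈ models K) (hg' : g' ∈ models K)
    {t : ℝ} (h : (setting K ε hε).paretoDist g g' ≤ t) (j : Fin K) :
    (setting K ε hε).risk (target ε j) g - (setting K ε hε).risk (target ε j) g' ≤ t := by
  rw [paretoDist_le_iff] at h
  rw [risk_target hε hg, risk_target hε hg']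
  obtain ⟨ρ, hρ, m, -, e⟩ := exists_tiltMean_eq hg
  obtain ⟨ρ', hρ', m', -, e'⟩ := exists_tiltMean_eq hg'
  simp only [e, e'] at h ⊢
  have hm : m - m' ≤ t := by
    have hs : ∑ k, ((m - 1 / 2 * ρ k) - (m' - 1 / 2 * ρ' k)) ≤ ∑ _k : Fin K, t :=
      Finset.sum_le_sum fun k _ => h k
    simp only [Finset.sum_sub_distrib, ← Finset.mul_sum, hρ.2, hρ'.2, Finset.sum_const,
      Finset.card_univ, Fintype.card_fin, nsmul_eq_mul] at hs
    have hK : (0 : ℝ) < K := Nat.cast_pos.2 (NeZero.pos K)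
    nlinarith
  nlinarith [h j, hε.1, hε.2]

lemma lowerModulus_ge (j : Fin K) (t : ℝ) (ht : t ≤ 1) :
    t ≤ (setting K ε hε).lowerModulus (target ε j) t := by
  unfold ProblemSetting.lowerModulus
  split_ifs with h
  · obtain ⟨g, hg, g', hg', hd⟩ := h
    refine le_csInf ⟨_, g, hg, g', hg', hd, rfl⟩ ?_
    rintro _ ⟨g, hg, g', hg', hd, rfl⟩
    linarith [risk_sub_risk_le hε hg hg' hd j]
  · exact ht

lemma upperModulus_le (j : Fin K) (t : ℝ) (ht : 0 ≤ t) :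
    (setting K ε hε).upperModulus (target ε j) t ≤ t := by
  refine csSup_le ⟨_, bit j, bit_mem_models j, bit j, bit_mem_models j, ?_, rfl⟩ ?_
  · rw [paretoDist_le_iff]; simpa using ht
  · rintro _ ⟨g, hg, g', hg', hd, rfl⟩
    exact risk_sub_risk_le hε hg hg' hd j

/-- The maximum over `k` of the benchmark differences is at least their `ρ`-weighted average.
Completing the square in `ρ - γ` bounds this average below by `(|ρ|² - 1)/4`, the common difference
attained by the square. -/
lemma isParetoMap_bitMixSq : (setting K ε hε).IsParetoMap bitMixSq := by
  refine fun ρ hρ => ⟨⟨ρ, hρ, Or.inr rfl⟩, fun g hg => ?_⟩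
  obtain ⟨γ, hγ, m, hm, e⟩ := exists_tiltMean_eq hg
  refine (paretoDist_le_iff hε _ _ _).2 fun k => ?_
  have hd := (paretoDist_le_iff hε g (bitMix ρ) _).1 le_rfl
  change _ ≤ (setting K ε hε).paretoDist g (bitMix ρ)
  set D := (setting K ε hε).paretoDist g (bitMix ρ)
  have e1 := tiltMean_bitMix_sq (1 / 2) k hρ.2
  have e2 := fun k => tiltMean_bitMix (1 / 2) k hρ.2
  simp only [e, e2] at hd
  have hs : ∑ k, ρ k * (m - 1 / 2 * γ k - (1 / 2 - 1 / 2 * ρ k)) ≤ ∑ k, ρ k * D :=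
    Finset.sum_le_sum fun k _ => mul_le_mul_of_nonneg_left (hd k) (hρ.1 k)
  have hs' : ∑ k, ρ k * (m - 1 / 2 * γ k - (1 / 2 - 1 / 2 * ρ k)) =
      m - 1 / 2 + 1 / 4 * ∑ k, ρ k ^ 2 - 1 / 4 * ∑ k, γ k ^ 2 +
        1 / 4 * ∑ k, (ρ k - γ k) ^ 2 := by
    have : m - 1 / 2 = (∑ k, ρ k) * (m - 1 / 2) := by rw [hρ.2, one_mul]
    rw [this, Finset.sum_mul]
    simp only [Finset.mul_sum, ← Finset.sum_add_distrib, ← Finset.sum_sub_distrib]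
    exact Finset.sum_congr rfl fun k _ => by ring
  rw [hs', ← Finset.sum_mul, hρ.2, one_mul] at hs
  have hsq : 0 ≤ ∑ k, (ρ k - γ k) ^ 2 := Finset.sum_nonneg fun k _ => sq_nonneg _
  change tiltMean (1 / 2) k (fun x => bitMix ρ x ^ 2) - tiltMean (1 / 2) k (bitMix ρ) ≤ D
  rw [e1, e2]
  linarith

lemma paretoGap_bitMixSq {ρ : Fin K → ℝ} (hρ : ρ ∈ stdSimplex ℝ (Fin K)) :
    (setting K ε hε).paretoGap bitMixSq ρ = (1 - ∑ k, ρ k ^ 2) / 4 := by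
  have e : ∀ k, (setting K ε hε).R k ((setting K ε hε).mix ρ) -
      (setting K ε hε).R k (bitMixSq ρ) = (1 - ∑ k, ρ k ^ 2) / 4 := fun k => by
    change tiltMean (1 / 2) k (bitMix ρ) - tiltMean (1 / 2) k (fun x => bitMix ρ x ^ 2) = _
    rw [tiltMean_bitMix _ _ hρ.2, tiltMean_bitMix_sq _ _ hρ.2]; ring
  unfold ProblemSetting.paretoGap
  simp only [e]
  exact ciInf_const

lemma sqDist_target {ρ γ : Fin K → ℝ} (hρ : ρ ∈ stdSimplex ℝ (Fin K))
    (hγ : γ ∈ stdSimplex ℝ (Fin K)) (j : Fin K) :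
    (setting K ε hε).sqDist (target ε j) ((setting K ε hε).mix ρ) ((setting K ε hε).mix γ) =
      (∑ k, (ρ k - γ k) ^ 2) / 4 := by
  change ∫ x, (bitMix ρ x - bitMix γ x) ^ 2 ∂((target ε j).map Prod.fst) = _
  rw [target_map_fst, integral_tiltMeasure hε, tiltMean_bitMix_sub_sq _ _ (hρ.2.trans hγ.2.symm)]

lemma fastRateAssumptions_target (j : Fin K) :
    (setting K ε hε).FastRateAssumptions (target ε j) bitMixSq
      ((setting K ε hε).paretoGap bitMixSq) 1 2 2 0 where
  gap :=
    { nonneg := fun ρ hρ => by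
        rw [paretoGap_bitMixSq hε hρ]; linarith [sq_sum_le_one hρ]
      dirac := fun k => by
        rw [paretoGap_bitMixSq hε (single_mem_stdSimplex ℝ k)]
        simp [Pi.single_apply]
      concave := fun α hα ρ hρ γ hγ => by
        rw [paretoGap_bitMixSq hε hρ, paretoGap_bitMixSq hε hγ, sqDist_target hε hρ hγ,
          paretoGap_bitMixSq hε (convex_stdSimplex ℝ (Fin K) hρ hγ hα.1
            (sub_nonneg.2 hα.2) (by ring))]
        have e : ∑ k, (α • ρ + (1 - α) • γ) k ^ 2 = α * ∑ k, ρ k ^ 2 +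
            (1 - α) * ∑ k, γ k ^ 2 - α * (1 - α) * ∑ k, (ρ k - γ k) ^ 2 := by
          simp only [Finset.mul_sum, ← Finset.sum_add_distrib, ← Finset.sum_sub_distrib]
          refine Finset.sum_congr rfl fun k _ => ?_
          simp only [Pi.add_apply, Pi.smul_apply, smul_eq_mul]; ring
        rw [e]
        -- Concavity with `η = 2` is an equality: the gap is `-|ρ|²/4` up to a constant, and the
        -- squared `L²` distance is `|ρ - γ|²/4`.
        exact le_of_eq (by ring)
      mem := fun ρ hρ => ⟨ρ, hρ, Or.inr rfl⟩
      realized := fun ρ hρ k => by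
        rw [paretoGap_bitMixSq hε hρ]
        change tiltMean (1 / 2) k (fun x => bitMix ρ x ^ 2) = tiltMean (1 / 2) k (bitMix ρ) - _
        rw [tiltMean_bitMix _ _ hρ.2, tiltMean_bitMix_sq _ _ hρ.2]; ring }
  lower t ht := lowerModulus_ge hε j t ht.2
  upper t ht := upperModulus_le hε j t ht.1
  mix_mem ρ hρ x := bitMix_mem hρ x
  map_mem ρ hρ x := bitMixSq_mem hρ x
  strongConvex y _ := by
    rw [strongConvexOn_zero]
    refine ⟨convex_Icc 0 1, fun a _ b _ s t hs ht hst => ?_⟩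
    change |s * a + t * b - y| ≤ s * |a - y| + t * |b - y|
    have : s * a + t * b - y = s * (a - y) + t * (b - y) := by linear_combination y * hst
    rw [this]
    refine (abs_add_le _ _).trans_eq ?_
    rw [abs_mul, abs_mul, abs_of_nonneg hs, abs_of_nonneg ht]
  lipschitz_loss y _ v _ v' _ := by
    rw [one_mul]
    change |(|v - y| - |v' - y|)| ≤ _
    simpa using abs_abs_sub_abs_le (v - y) (v' - y)
  lipschitz_map ρ hρ γ hγ x := by
    change |bitMix ρ x ^ 2 - bitMix γ x ^ 2| ≤ 2 * |bitMix ρ x - bitMix γ x|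
    have h1 := bitMix_mem hρ x
    have h2 := bitMix_mem hγ x
    rw [sq_sub_sq, abs_mul]
    refine mul_le_mul_of_nonneg_right ?_ (abs_nonneg _)
    rw [abs_of_nonneg (add_nonneg h1.1 h2.1)]
    linarith [h1.2, h2.2]

end Setting

/-! ### Lower bound for mixtures -/

lemma sum_prod_tiltDensity (ε : ℝ) (j : Fin K) (n : ℕ) :
    ∑ x : Fin n → Fin K → Bool, ∏ i, tiltDensity ε j (x i) = 1 := by
  rw [← Fintype.sum_pow fun x => tiltDensity ε j x]
  have := sum_tiltDensity_mul ε j fun _ => 1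
  rw [tiltMean_one] at this
  simp only [mul_one] at this
  rw [this, one_pow]

/-- The second moment of the likelihood ratio of a tilted sample. -/
lemma sum_prod_tiltDensity_mul_likelihood (ε : ℝ) (j : Fin K) (n : ℕ) :
    ∑ x : Fin n → Fin K → Bool,
      (∏ i, tiltDensity ε j (x i)) * ∏ i, (1 + 2 * ε * spin j (x i)) = (1 + 4 * ε ^ 2) ^ n := by
  simp only [← Finset.prod_mul_distrib]
  rw [← Fintype.sum_pow fun x => tiltDensity ε j x * (1 + 2 * ε * spin j x), sum_tiltDensity_mul]
  congr 1
  have e : ∀ x : Fin K → Bool, (1 + 2 * ε * spin j x) * (1 + 2 * ε * spin j x) =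
      (1 + 4 * ε ^ 2) + 4 * ε * spin j x := fun x => by
    linear_combination 4 * ε ^ 2 * spin_mul_self j x
  simp only [tiltMean, e, Finset.expect_add_distrib, ← Finset.mul_expect, expect_spin,
    Finset.expect_const Finset.univ_nonempty]
  ring

lemma prod_tiltDensity_eq (ε : ℝ) (j : Fin K) {n : ℕ} (x : Fin n → Fin K → Bool) :
    ∏ i, tiltDensity ε j (x i) = ((2 ^ K) ^ n)⁻¹ * ∏ i, (1 + 2 * ε * spin j (x i)) := by
  simp only [tiltDensity, Finset.prod_div_distrib, Finset.prod_const, Finset.card_univ,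
    Fintype.card_fin]
  rw [div_eq_inv_mul]

/-- No map from samples to the simplex can put much weight on the tilted coordinate on average
over all the coordinates that may be tilted. -/
lemma exists_sum_prod_tiltDensity_mul_le [NeZero K] {ε : ℝ} {n : ℕ}
    (h : (1 + 4 * ε ^ 2) ^ n ≤ K / 2) (ρ : (Fin n → Fin K → Bool) → Fin K → ℝ)
    (hρ : ∀ x, ρ x ∈ stdSimplex ℝ (Fin K)) :
    ∃ j, ∑ x, (∏ i, tiltDensity ε j (x i)) * ρ x j ≤ 3 / 4 := by
  have hK : (0 : ℝ) < K := Nat.cast_pos.2 (NeZero.pos K)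
  set L : Fin K → (Fin n → Fin K → Bool) → ℝ := fun j x => ∏ i, (1 + 2 * ε * spin j (x i))
  have hpt : ∀ x, ∑ j, (∏ i, tiltDensity ε j (x i)) * ρ x j ≤
      ((2 ^ K) ^ n)⁻¹ * (K / 4) + ∑ j, 1 / K * ((∏ i, tiltDensity ε j (x i)) * L j x) := by
    intro x
    have e : ((2 ^ K) ^ n)⁻¹ * (K / 4 : ℝ) = ∑ j, ((2 ^ K) ^ n)⁻¹ * (K / 4 : ℝ) * ρ x j := by
      rw [← Finset.mul_sum, (hρ x).2, mul_one]
    rw [e, ← Finset.sum_add_distrib]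
    refine Finset.sum_le_sum fun j _ => ?_
    have h0 := (hρ x).1 j
    have h1 : ρ x j ≤ 1 :=
      (hρ x).2 ▸ Finset.single_le_sum (fun l _ => (hρ x).1 l) (Finset.mem_univ j)
    rw [prod_tiltDensity_eq]
    change ((2 ^ K) ^ n)⁻¹ * L j x * _ ≤ _ + 1 / (K : ℝ) * (((2 ^ K) ^ n)⁻¹ * L j x * L j x)
    -- The threshold is `K / 4` because the weights `ρ x j` sum to `1` over `j`: this term
    -- contributes `K / 4` in total and the second moments at most `K / 2`, so the average over `j`
    -- is at most `3 / 4`.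
    have hL : L j x ≤ K / 4 + L j x ^ 2 / K := by
      have : 0 ≤ (K / 2 - L j x) ^ 2 / K := by positivity
      have e : (K / 2 - L j x) ^ 2 / K = K / 4 - L j x + L j x ^ 2 / K := by field_simp; ring
      linarith
    have hq : 0 ≤ L j x ^ 2 / K := by positivity
    have : L j x * ρ x j ≤ K / 4 * ρ x j + L j x ^ 2 / K := by nlinarith
    have := mul_le_mul_of_nonneg_left this (by positivity : (0 : ℝ) ≤ ((2 ^ K) ^ n)⁻¹)
    calc _ = ((2 ^ K) ^ n)⁻¹ * (L j x * ρ x j) := by ring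
      _ ≤ _ := this
      _ = _ := by ring
  have hsum : ∑ j, ∑ x, (∏ i, tiltDensity ε j (x i)) * ρ x j ≤ ∑ _j : Fin K, (3 / 4 : ℝ) := by
    rw [Finset.sum_comm]
    refine (Finset.sum_le_sum fun x _ => hpt x).trans ?_
    rw [Finset.sum_add_distrib, Finset.sum_comm]
    simp only [← Finset.mul_sum, L, sum_prod_tiltDensity_mul_likelihood]
    simp only [Finset.sum_const, Finset.card_univ, Fintype.card_fin, nsmul_eq_mul,
      Fintype.card_pi, Fintype.card_bool, Finset.prod_const]
    push_cast
    have h1 : ((2 : ℝ) ^ K) ^ n * (((2 ^ K) ^ n)⁻¹ * (K / 4)) = K / 4 := by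
      rw [mul_inv_cancel_left₀ (by positivity)]
    have h2 : (K : ℝ) * (1 / K * (1 + 4 * ε ^ 2) ^ n) = (1 + 4 * ε ^ 2) ^ n := by
      field_simp
    linarith
  obtain ⟨j, -, hj⟩ := Finset.exists_le_of_sum_le Finset.univ_nonempty hsum
  exact ⟨j, hj⟩

section Setting

variable [NeZero K] {ε : ℝ} (hε : ε ∈ Icc (0 : ℝ) (1 / 2))

/-- The sample space is finite and discrete, so every estimator qualifies. -/
lemma hasExpectedExcessRisk {n : ℕ} (est : (Fin n → (setting K ε hε).Z) → (setting K ε hε).X → ℝ) :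
    (setting K ε hε).HasExpectedExcessRisk est := by
  rintro _ ⟨j, rfl⟩
  have := isProbabilityMeasure_target hε j
  have key : ∀ g : (Fin n → (Fin K → Bool) × Labels) → ℝ,
      Integrable g (Measure.pi fun _ : Fin n => target ε j) := fun g => Integrable.of_finite
  exact key _

/-- The expected excess risk of an estimator with values in the model class. -/
lemma expectedExcessRisk_target {n : ℕ}
    (est : (Fin n → (Fin K → Bool) × Labels) → (Fin K → Bool) → ℝ)
    (hest : ∀ z, est z ∈ models K) (j : Fin K) :
    (setting K ε hε).expectedExcessRisk est (target ε j) =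
      ∑ x : Fin n → Fin K → Bool, (∏ i, tiltDensity ε j (x i)) *
        (tiltMean ε j (est fun i => labelled (x i)) - (1 / 2 - ε)) := by
  refine (integral_pi_target hε j _).trans (Finset.sum_congr rfl fun x _ => ?_)
  rw [excessRisk_target hε (hest _)]

/-- Proper aggregation cannot beat the slow rate. -/
lemma le_worstCaseExcessRisk_mix {n : ℕ} (h : (1 + 4 * ε ^ 2) ^ n ≤ K / 2)
    (ρ : (Fin n → (Fin K → Bool) × Labels) → Fin K → ℝ) (hρ : ∀ z, ρ z ∈ stdSimplex ℝ (Fin K)) :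
    ε / 4 ≤ (setting K ε hε).worstCaseExcessRisk fun z => (setting K ε hε).mix (ρ z) := by
  obtain ⟨j, hj⟩ := exists_sum_prod_tiltDensity_mul_le h (fun x => ρ fun i => labelled (x i))
    fun x => hρ _
  have hfin : Finite (setting K ε hε).Qs := (finite_range (target (K := K) ε)).to_subtype
  refine le_trans ?_ (le_ciSup (finite_range _).bddAbove
    (⟨target ε j, mem_range_self j⟩ : (setting K ε hε).Qs))
  refine le_of_le_of_eq ?_
    (expectedExcessRisk_target hε (fun z => bitMix (ρ z)) (fun z => ⟨_, hρ z, Or.inl rfl⟩) j).symm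
  have e : ∀ x : Fin n → Fin K → Bool, (∏ i, tiltDensity ε j (x i)) *
        (tiltMean ε j (bitMix (ρ fun i => labelled (x i))) - (1 / 2 - ε)) =
      ε * ∏ i, tiltDensity ε j (x i) -
        ε * ((∏ i, tiltDensity ε j (x i)) * ρ (fun i => labelled (x i)) j) := fun x => by
    rw [tiltMean_bitMix _ _ (hρ _).2]; ring
  simp only [e]
  rw [Finset.sum_sub_distrib, ← Finset.mul_sum, ← Finset.mul_sum, sum_prod_tiltDensity]
  nlinarith [hε.1]

end Setting

/-! ### Upper bound for the fast-rate aggregator -/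

/-- How much the mean of the `k`-th and `j`-th coordinates is worse for the aggregation objective
than any mixture concentrated around the `k`-th coordinate, at one observation. -/
def midpointLoss (ε : ℝ) (j k : Fin K) (x : Fin K → Bool) : ℝ :=
  ((bit k x + bit j x) / 2) ^ 2 + (bit k x + bit j x) / 2 - (2 - 12 * ε) * bit k x

lemma exp_le_quadratic {u v : ℝ} (h : u ≤ v) (hv : |v| ≤ 1) : Real.exp u ≤ 1 + v + v ^ 2 := by
  have := (abs_le.1 (Real.abs_exp_sub_one_sub_id_le hv)).2
  linarith [Real.exp_le_exp.2 h]

/-- At `ε = 0` the midpoint loss takes the values `0`, `3/4`, `-5/4`, `0` with equal probability,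
hence has mean `-1/8`; a small exponential moment is thus below `1`. -/
lemma tiltMean_exp_midpointLoss_le {ε : ℝ} (hε : ε ∈ Icc (0 : ℝ) (1 / 1408)) {j k : Fin K}
    (h : k ≠ j) : tiltMean ε j (fun x => Real.exp (midpointLoss ε j k x / 10)) ≤ 199 / 200 := by
  have hε' : ε ∈ Icc (0 : ℝ) (1 / 2) := ⟨hε.1, hε.2.trans (by norm_num)⟩
  -- Every function of two bits is bilinear in their signs. These coefficients interpolate the
  -- majorants `1`, `1.081`, `0.892`, `1.001` at the four sign patterns; the negative coefficient of
  -- `spin j` means that the tilt only helps.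
  refine (tiltMean_mono hε' j (g' := fun x => 0.9935 + 0.047 * spin k x + (-0.0475) * spin j x +
    0.007 * (spin k x * spin j x)) fun x => ?_).trans ?_
  · obtain ⟨h0, h1⟩ := hε
    unfold midpointLoss bit spin
    cases x k <;> cases x j <;> simp only [Bool.false_eq_true, if_true, if_false]
    · norm_num
    · refine (exp_le_quadratic (v := 0.075) (by norm_num) (by norm_num [abs_le])).trans ?_
      norm_num
    · refine (exp_le_quadratic (v := -0.124) (by linarith) (by norm_num [abs_le])).trans ?_
      norm_num
    · refine (exp_le_quadratic (v := 0.0009) (by linarith) (by norm_num [abs_le])).trans ?_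
      norm_num
  · rw [tiltMean_pair ε h]
    linarith [hε.1]

section Setting

variable [NeZero K] {ε : ℝ} (hε : ε ∈ Icc (0 : ℝ) (1 / 2))

lemma exists_isFastRateAggregator (n : ℕ) :
    ∃ ρ : (Fin n → (setting K ε hε).Z) → Fin K → ℝ,
      (setting K ε hε).IsFastRateAggregator bitMixSq ρ := by
  have key : ∀ z : Fin n → (setting K ε hε).Z, ∃ ρ ∈ stdSimplex ℝ (Fin K),
      IsMinOn ((setting K ε hε).aggObjective bitMixSq z) (stdSimplex ℝ (Fin K)) ρ := fun z => by
    refine (isCompact_stdSimplex ℝ (Fin K)).exists_isMinOn ⟨_, single_mem_stdSimplex ℝ 0⟩ ?_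
    refine Continuous.continuousOn ?_
    have hc : ∀ (x : Fin K → Bool) (y : ℝ), Continuous fun ρ => |bitMixSq ρ x - y| := fun x y => by
      unfold bitMixSq bitMix; fun_prop
    unfold ProblemSetting.aggObjective ProblemSetting.empRisk
    refine ((((continuous_finsetSum _ fun i _ => hc (z i).1 (z i).2).const_mul _)).const_mul _).add
      ?_
    fun_prop
  choose ρ h1 h2 using key
  exact ⟨ρ, fun z => ⟨h1 z, h2 z⟩⟩

/-- With label `0` the loss is linear, so the averaged dictionary risk is the risk of the mixture.
-/
lemma aggObjective_labelled {n : ℕ} (x : Fin n → Fin K → Bool) {ρ : Fin K → ℝ}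
    (hρ : ρ ∈ stdSimplex ℝ (Fin K)) :
    (setting K ε hε).aggObjective bitMixSq (fun i => labelled (x i)) ρ =
      1 / 2 * (1 / n * ∑ i, (bitMix ρ (x i) ^ 2 + bitMix ρ (x i))) := by
  change 1 / 2 * (1 / (n : ℝ) * ∑ i, |bitMixSq ρ (x i) - 0|) +
    1 / 2 * ∑ k, ρ k * (1 / (n : ℝ) * ∑ i, |bit k (x i) - 0|) = _
  have e1 : ∀ i, |bitMixSq ρ (x i) - 0| = bitMix ρ (x i) ^ 2 := fun i => by
    rw [sub_zero, abs_of_nonneg (bitMixSq_mem hρ _).1, bitMixSq]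
  have e2 : ∀ k i, |bit k (x i) - 0| = bit k (x i) := fun k i => by
    rw [sub_zero, abs_of_nonneg (bit_mem k _).1]
  have e3 : ∑ k, ρ k * (1 / (n : ℝ) * ∑ i, bit k (x i)) = 1 / n * ∑ i, bitMix ρ (x i) := by
    simp only [bitMix]
    rw [Finset.sum_comm, Finset.mul_sum]
    refine Finset.sum_congr rfl fun k _ => ?_
    rw [← Finset.mul_sum]; ring
  simp only [e1, e2, e3, Finset.sum_add_distrib]
  ring

/-- The midpoint of the `k`-th and `j`-th coordinates bounds the objective at a minimizer, which
is therefore unlikely to be concentrated around the `k`-th coordinate. -/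
lemma sum_midpointLoss_nonneg {n : ℕ} (hn : 0 < n) (x : Fin n → Fin K → Bool) {ρ : Fin K → ℝ}
    (hρ : ρ ∈ stdSimplex ℝ (Fin K))
    (hmin : IsMinOn ((setting K ε hε).aggObjective bitMixSq fun i => labelled (x i))
      (stdSimplex ℝ (Fin K)) ρ) (hε4 : 4 * ε ≤ 1) {j k : Fin K} (hk : 1 - 4 * ε ≤ ρ k) :
    0 ≤ ∑ i, midpointLoss ε j k (x i) := by
  set γ : Fin K → ℝ := (1 / 2 : ℝ) • Pi.single k 1 + (1 / 2 : ℝ) • Pi.single j 1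
  have hγ : γ ∈ stdSimplex ℝ (Fin K) :=
    convex_stdSimplex ℝ (Fin K) (single_mem_stdSimplex ℝ k) (single_mem_stdSimplex ℝ j)
      (by norm_num) (by norm_num) (by norm_num)
  have hmix : ∀ y, bitMix γ y = (bit k y + bit j y) / 2 := fun y => by
    simp only [bitMix, γ, Pi.add_apply, Pi.smul_apply, smul_eq_mul, Pi.single_apply, add_mul,
      Finset.sum_add_distrib]
    simp
    ring
  have h : (setting K ε hε).aggObjective bitMixSq (fun i => labelled (x i)) ρ ≤
      (setting K ε hε).aggObjective bitMixSq (fun i => labelled (x i)) γ := hmin hγ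
  rw [aggObjective_labelled hε x hρ, aggObjective_labelled hε x hγ] at h
  have hn' : (0 : ℝ) < 1 / n := by positivity
  have h' := le_of_mul_le_mul_left (le_of_mul_le_mul_left h (by norm_num)) hn'
  rw [← sub_nonneg, ← Finset.sum_sub_distrib] at h'
  refine h'.trans (Finset.sum_le_sum fun i _ => ?_)
  rw [hmix, midpointLoss]
  refine sub_le_sub_left ?_ _
  have hb : ρ k * bit k (x i) ≤ bitMix ρ (x i) :=
    Finset.single_le_sum (f := fun l => ρ l * bit l (x i))
      (fun l _ => mul_nonneg (hρ.1 l) (bit_mem l _).1) (Finset.mem_univ k)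
  have h0 := (bitMix_mem hρ (x i)).1
  revert hb
  unfold bit
  -- If `bit k = 1`, the mixture is at least `1 - 4ε`, and `(1 - 4ε)² + (1 - 4ε) ≥ 2 - 12ε`;
  -- otherwise nonnegativity is enough.
  split_ifs
  · intro hb
    nlinarith [hε.1]
  · intro _
    nlinarith

/-- The excess risk of the fast-rate aggregator on a sample. -/
lemma tiltMean_bitMixSq_sub_le {n : ℕ} (hn : 0 < n) (x : Fin n → Fin K → Bool) {ρ : Fin K → ℝ}
    (hρ : ρ ∈ stdSimplex ℝ (Fin K))
    (hmin : IsMinOn ((setting K ε hε).aggObjective bitMixSq fun i => labelled (x i))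
      (stdSimplex ℝ (Fin K)) ρ) (hε4 : 4 * ε ≤ 1) (j : Fin K) :
    tiltMean ε j (bitMixSq ρ) - (1 / 2 - ε) ≤
      ε * ∑ k ∈ Finset.univ.erase j, ∏ i, Real.exp (midpointLoss ε j k (x i) / 10) := by
  have hnn : ∀ k ∈ Finset.univ.erase j,
      0 ≤ ∏ i, Real.exp (midpointLoss ε j k (x i) / 10) := fun k _ =>
    Finset.prod_nonneg fun i _ => (Real.exp_pos _).le
  have hexc : tiltMean ε j (bitMixSq ρ) - (1 / 2 - ε) =
      ε * (1 - ρ j) - (1 - ∑ k, ρ k ^ 2) / 4 := by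
    refine (congrArg (· - _) (tiltMean_bitMix_sq ε j hρ.2)).trans ?_
    ring
  rw [hexc]
  obtain ⟨k, -, hk⟩ := Finset.exists_max_image Finset.univ ρ Finset.univ_nonempty
  have hsq : ∑ l, ρ l ^ 2 ≤ ρ k := by
    have : ∑ l, ρ l ^ 2 ≤ ∑ l, ρ k * ρ l := Finset.sum_le_sum fun l hl => by
      rw [sq]; exact mul_le_mul_of_nonneg_right (hk l hl) (hρ.1 l)
    rwa [← Finset.mul_sum, hρ.2, mul_one] at this
  have hle : ∀ l, ρ l ≤ 1 := fun l =>
    hρ.2 ▸ Finset.single_le_sum (fun m _ => hρ.1 m) (Finset.mem_univ l)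
  have hrhs := mul_nonneg hε.1 (Finset.sum_nonneg hnn)
  by_cases hpos : ε * (1 - ρ j) - (1 - ∑ k, ρ k ^ 2) / 4 ≤ 0
  · exact hpos.trans hrhs
  -- If `j` had the largest weight, then `|ρ|² ≤ ρ_j` and `4ε ≤ 1` would make the excess
  -- nonpositive.
  have hkj : k ≠ j := by
    rintro rfl
    nlinarith [hle k]
  have hk4 : 1 - 4 * ε ≤ ρ k := by nlinarith [hρ.1 j, hε.1]
  have hs := sum_midpointLoss_nonneg hε hn x hρ hmin hε4 (j := j) hk4
  -- The exponential product dominates the indicator of the bad event; summing over `k` is the union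
  -- bound.
  have h1 : 1 ≤ ∏ i, Real.exp (midpointLoss ε j k (x i) / 10) := by
    rw [← Real.exp_sum, ← Finset.sum_div]
    exact Real.one_le_exp (by positivity)
  have h2 := h1.trans (Finset.single_le_sum hnn (Finset.mem_erase.2 ⟨hkj, Finset.mem_univ k⟩))
  have h3 := mul_le_mul_of_nonneg_left h2 hε.1
  nlinarith [hρ.1 j, sq_sum_le_one hρ, hε.1]

lemma worstCaseExcessRisk_bitMixSq_le {n : ℕ} (ρ : (Fin n → (Fin K → Bool) × Labels) → Fin K → ℝ)
    (hρ : ∀ z, ρ z ∈ stdSimplex ℝ (Fin K)) {b : ℝ}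
    (h : ∀ j : Fin K, ∑ x : Fin n → Fin K → Bool, (∏ i, tiltDensity ε j (x i)) *
      (tiltMean ε j (bitMixSq (ρ fun i => labelled (x i))) - (1 / 2 - ε)) ≤ b) :
    (setting K ε hε).worstCaseExcessRisk (fun z => bitMixSq (ρ z)) ≤ b := by
  have : Nonempty (setting K ε hε).Qs := (setting K ε hε).Qs_nonempty.to_subtype
  refine ciSup_le ?_
  rintro ⟨_, j, rfl⟩
  exact (expectedExcessRisk_target hε (fun z => bitMixSq (ρ z))
    (fun z => ⟨_, hρ z, Or.inr rfl⟩) j).trans_le (h j)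

/-- The excess risk of the fast-rate aggregator never exceeds the tilt. -/
lemma worstCaseExcessRisk_bitMixSq_le_tilt {n : ℕ}
    (ρ : (Fin n → (Fin K → Bool) × Labels) → Fin K → ℝ) (hρ : ∀ z, ρ z ∈ stdSimplex ℝ (Fin K)) :
    (setting K ε hε).worstCaseExcessRisk (fun z => bitMixSq (ρ z)) ≤ ε := by
  refine worstCaseExcessRisk_bitMixSq_le hε ρ hρ fun j => ?_
  refine (Finset.sum_le_sum fun x _ => mul_le_mul_of_nonneg_left (?_ : _ ≤ ε)
    (Finset.prod_nonneg fun i _ => tiltDensity_nonneg hε j (x i))).trans_eq ?_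
  · have hs := hρ fun i => labelled (x i)
    have := tiltMean_bitMix_sq ε j hs.2
    change tiltMean ε j (fun y => bitMix _ y ^ 2) - _ ≤ _
    rw [this]
    nlinarith [hs.1 j, sq_sum_le_one hs, hε.1]
  · rw [← Finset.sum_mul, sum_prod_tiltDensity, one_mul]

/-- For a small tilt, the excess risk of the fast-rate aggregator is exponentially small. -/
lemma worstCaseExcessRisk_bitMixSq_le_exp {n : ℕ} (hn : 0 < n) (hε' : ε ≤ 1 / 1408)
    (ρ : (Fin n → (Fin K → Bool) × Labels) → Fin K → ℝ)
    (hρ : (setting K ε hε).IsFastRateAggregator bitMixSq ρ) :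
    (setting K ε hε).worstCaseExcessRisk (fun z => bitMixSq (ρ z)) ≤
      ε * (K * (199 / 200) ^ n) := by
  refine worstCaseExcessRisk_bitMixSq_le hε ρ (fun z => (hρ z).1) fun j => ?_
  have hp : ∀ x : Fin n → Fin K → Bool, 0 ≤ ∏ i, tiltDensity ε j (x i) := fun x =>
    Finset.prod_nonneg fun i _ => tiltDensity_nonneg hε j (x i)
  refine (Finset.sum_le_sum fun x _ => mul_le_mul_of_nonneg_left (tiltMean_bitMixSq_sub_le hε hn x
    (hρ _).1 (hρ _).2 (by linarith) j) (hp x)).trans ?_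
  simp only [mul_left_comm _ ε, ← Finset.mul_sum]
  refine mul_le_mul_of_nonneg_left ?_ hε.1
  simp only [Finset.mul_sum]
  rw [Finset.sum_comm]
  have hk : ∀ k ∈ Finset.univ.erase j, ∑ x : Fin n → Fin K → Bool,
      (∏ i, tiltDensity ε j (x i)) * ∏ i, Real.exp (midpointLoss ε j k (x i) / 10) ≤
        (199 / 200) ^ n := fun k hk => by
    simp only [← Finset.prod_mul_distrib]
    rw [← Fintype.sum_pow fun x => tiltDensity ε j x * Real.exp (midpointLoss ε j k x / 10),
      sum_tiltDensity_mul]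
    refine pow_le_pow_left₀ ?_
      (tiltMean_exp_midpointLoss_le ⟨hε.1, hε'⟩ (Finset.ne_of_mem_erase hk)) n
    rw [← sum_tiltDensity_mul]
    exact Finset.sum_nonneg fun x _ => mul_nonneg (tiltDensity_nonneg hε j x) (Real.exp_pos _).le
  refine (Finset.sum_le_sum hk).trans ?_
  rw [Finset.sum_const, nsmul_eq_mul]
  refine mul_le_mul_of_nonneg_right ?_ (by positivity)
  exact_mod_cast (Finset.card_le_univ _).trans_eq (Fintype.card_fin K)

end Setting

/-! ### The choice of the tilt -/

lemma one_le_log_of_four_le {K : ℕ} (hK : 4 ≤ K) : 1 ≤ Real.log K := by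
  rw [Real.le_log_iff_exp_le (by positivity)]
  have : (4 : ℝ) ≤ K := by exact_mod_cast hK
  linarith [Real.exp_one_lt_d9]

/-- The moment is at most `K ^ (1/16) ≤ √K`, and `√K ≤ K / 2` is where `4 ≤ K` is needed. -/
lemma likelihood_moment_le {K n : ℕ} (hK : 4 ≤ K) (hn : 0 < n) {ε : ℝ}
    (hε : ε ^ 2 = Real.log K / n / 64) : (1 + 4 * ε ^ 2) ^ n ≤ (K : ℝ) / 2 := by
  have hK' : (4 : ℝ) ≤ K := by exact_mod_cast hK
  have hn' : (0 : ℝ) < n := Nat.cast_pos.2 hn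
  have h1 : (1 + 4 * ε ^ 2) ^ n ≤ Real.exp (Real.log K / 16) := by
    have : Real.log K / 16 = n * (4 * ε ^ 2) := by rw [hε]; field_simp; ring
    rw [this, Real.exp_nat_mul]
    refine pow_le_pow_left₀ (by positivity) ?_ n
    linarith [Real.add_one_le_exp (4 * ε ^ 2)]
  have h2 : Real.exp (Real.log K / 16) ≤ √K := by
    rw [Real.sqrt_eq_rpow, Real.rpow_def_of_pos (by linarith)]
    refine Real.exp_le_exp.2 ?_
    linarith [one_le_log_of_four_le hK]
  refine (h1.trans h2).trans ?_
  rw [Real.sqrt_le_left (by positivity)]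
  nlinarith

lemma mul_pow_le_of_log_le {K n : ℕ} (hK : 4 ≤ K) (hn : 0 < n) {ε : ℝ} (hε0 : 0 ≤ ε)
    (hε : ε ^ 2 = Real.log K / n / 64) (hε' : ε ≤ 1 / 1408) :
    ε * (K * (199 / 200) ^ n) ≤ 22 * (Real.log K / n) := by
  have hK' : (4 : ℝ) ≤ K := by exact_mod_cast hK
  have hn' : (0 : ℝ) < n := Nat.cast_pos.2 hn
  -- Here `30976 = 1408² / 64`. So `log K` is negligible against `n / 200`, and the union bound only
  -- weakens the rate from `n / 200` to `n / 300`.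
  have hlog : Real.log K ≤ n / 30976 := by
    have : Real.log K = 64 * ε ^ 2 * n := by rw [hε]; field_simp
    rw [this]
    have : ε ^ 2 ≤ (1 / 1408) ^ 2 := pow_le_pow_left₀ hε0 hε' 2
    nlinarith
  have h1 : (199 / 200 : ℝ) ^ n ≤ Real.exp (-(n / 200)) := by
    have : -((n : ℝ) / 200) = n * (-1 / 200) := by ring
    rw [this, Real.exp_nat_mul]
    refine pow_le_pow_left₀ (by norm_num) ?_ n
    linarith [Real.add_one_le_exp (-1 / 200)]
  have h2 : (K : ℝ) * (199 / 200) ^ n ≤ Real.exp (-(n / 300)) := by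
    calc (K : ℝ) * (199 / 200) ^ n ≤ Real.exp (Real.log K) * Real.exp (-(n / 200)) := by
          rw [Real.exp_log (by linarith)]
          exact mul_le_mul_of_nonneg_left h1 (by linarith)
      _ = Real.exp (Real.log K - n / 200) := by rw [← Real.exp_add]; ring_nf
      _ ≤ _ := Real.exp_le_exp.2 (by linarith)
  have h3 : Real.exp (-((n : ℝ) / 300)) ≤ 300 / n := by
    rw [Real.exp_neg, ← inv_div (n : ℝ) 300]
    refine inv_anti₀ (by positivity) ?_
    linarith [Real.add_one_le_exp ((n : ℝ) / 300)]
  calc ε * (K * (199 / 200) ^ n) ≤ 1 / 1408 * (300 / n) :=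
        mul_le_mul hε' (h2.trans h3) (by positivity) (by norm_num)
    _ = 300 / 1408 / n := by ring
    _ ≤ 22 * Real.log K / n := by
        refine div_le_div_of_nonneg_right ?_ hn'.le
        linarith [one_le_log_of_four_le hK]
    _ = _ := by ring

end HypercubeAggregation

end

/-! ### Assembly -/

open HypercubeAggregation in
theorem mainTheorem6 (K n : ℕ) (hK : 4 ≤ K) (hn : 0 < n) (hKn : Real.log K / n ≤ 1) :
    ∃ S : ProblemSetting K,
      (∀ ρhat : (Fin n → S.Z) → Fin K → ℝ, (∀ z, ρhat z ∈ stdSimplex ℝ (Fin K)) →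
        S.HasExpectedExcessRisk (fun z => S.mix (ρhat z)) ∧
        1 / 38 * √(Real.log K / n) ≤ S.worstCaseExcessRisk fun z => S.mix (ρhat z)) ∧
      ∃ ψ : (Fin K → ℝ) → S.X → ℝ, S.IsParetoMap ψ ∧
        (∀ Q ∈ S.Qs, S.FastRateAssumptions Q ψ (S.paretoGap ψ) 1 2 2 0) ∧
        fastRateLambda 1 2 2 0 = 1 / 22 ∧
        (∃ ρfast : (Fin n → S.Z) → Fin K → ℝ, S.IsFastRateAggregator ψ ρfast) ∧
        ∀ ρfast : (Fin n → S.Z) → Fin K → ℝ, S.IsFastRateAggregator ψ ρfast →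
          S.HasExpectedExcessRisk (fun z => ψ (ρfast z)) ∧
          (S.worstCaseExcessRisk fun z => ψ (ρfast z)) ≤ 22 * (Real.log K / n) := by
  have : NeZero K := ⟨by omega⟩
  have hδ0 : 0 ≤ Real.log K / n := by positivity
  set δ := √(Real.log K / n) with hδ
  have hδsq : δ ^ 2 = Real.log K / n := Real.sq_sqrt hδ0
  have hδ1 : δ ≤ 1 := Real.sqrt_le_one.2 hKn
  have hδnn : 0 ≤ δ := Real.sqrt_nonneg _
  -- The tilt `δ / 8` yields the lower bound `δ / 32`, which exceeds `δ / 38`.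
  have hε : δ / 8 ∈ Icc (0 : ℝ) (1 / 2) := ⟨by positivity, by linarith⟩
  have hsq : (δ / 8) ^ 2 = Real.log K / n / 64 := by rw [div_pow, hδsq]; norm_num
  refine ⟨setting K (δ / 8) hε, fun ρ hρ => ⟨hasExpectedExcessRisk hε _, ?_⟩, bitMixSq,
    isParetoMap_bitMixSq hε, ?_, ?_, exists_isFastRateAggregator hε n, fun ρ hρ =>
      ⟨hasExpectedExcessRisk hε _, ?_⟩⟩
  · refine le_trans ?_ (le_worstCaseExcessRisk_mix hε (likelihood_moment_le hK hn hsq) ρ hρ)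
    linarith
  · rintro _ ⟨j, rfl⟩
    exact fastRateAssumptions_target hε j
  · norm_num [fastRateLambda]
  -- Since `log K / n = δ²`, failure of the trivial bound means `δ < 1 / 176`, that is, a tilt below
  -- `1 / 1408`.
  · by_cases h : δ / 8 ≤ 22 * (Real.log K / n)
    · exact (worstCaseExcessRisk_bitMixSq_le_tilt hε ρ fun z => (hρ z).1).trans h
    · have hδ2 : δ / 8 ≤ 1 / 1408 := by
        rw [← hδsq] at h
        nlinarith
      exact (worstCaseExcessRisk_bitMixSq_le_exp hε hn hδ2 ρ hρ).trans
        (mul_pow_le_of_log_le hK hn hε.1 hsq hδ2)
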